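/- Let $\mathcal B$ be a separable real Hilbert space, let $\mathcal B^*$ be a realization of its dual with pairing $[\cdot,\cdot]$, and let $Q:\mathcal B^*\to\mathcal B$ be a continuous linear bijection such that the inner product of $\mathcal B$ is $\langle u_1,u_2\rangle=[Q^{-1}u_1,u_2]$. Let $\phi_1,\dots,\phi_m\in\mathcal B^*$ have span $\Phi$ with $\dim\Phi<\dim\mathcal B$. Let $P_{Q\Phi}$ be the orthogonal projection of $\mathcal B$ onto $Q\Phi$, and let $\Phi^\perp(Q):\mathcal B^*\to\mathcal B$ be the short of $Q$, that is, the continuous symmetric operator with $$[s,\Phi^\perp(Q)s]=\inf_{t\in\Phi}\,[s+t,Q(s+t)],\qquad s\in\mathcal B^*$$ (it exists and is unique). *Game.* Let $L(\Phi,\mathcal B)$ be the set of maps $v:\mathcal B\to\mathcal B$ that are measurable from the $\sigma$-algebra generated by $u\mapsto[\phi_i,u]$, $i=1,\dots,m$, to the Borel $\sigma$-algebra. Let $\mathcal M_2(\mathcal B)$ be the set of Borel probability measures $\mu\neq\delta_0$ on $\mathcal B$ with $\int\|x\|^2d\mu<\infty$. Put $$\Psi(v,\mu)=\frac{\int\|x-v(x)\|^2\,d\mu(x)}{\int\|x\|^2\,d\mu(x)}\in[0,\infty].$$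 For $\epsilon\ge0$, a pair $(v^*,\mu^*)\in L(\Phi,\mathcal B)\times\mathcal M_2(\mathcal B)$ is an $\epsilon$-saddle point of $\Psi$ if $\Psi(v^*,\mu)-\epsilon\le\Psi(v^*,\mu^*)\le\Psi(v,\mu^*)+\epsilon$ for all $v\in L(\Phi,\mathcal B)$ and $\mu\in\mathcal M_2(\mathcal B)$. *Cylinder measures.* A cylinder measure $\nu$ on $\mathcal B$ is a family of Borel probability measures $F_*\nu$ on $F\mathcal B$, one for each continuous linear finite-rank projection $F$ of $\mathcal B$, with $(F_2)_*\nu=G_*((F_1)_*\nu)$ whenever $F_2=GF_1$ with $G:F_1\mathcal B\to F_2\mathcal B$ continuous and linear. A sequence converges in the weak cylinder-measure topology if its images under every such $F$ converge weakly. The Gaussian cylinder measure $\mu_S$ with covariance $S:\mathcal B^*\to\mathcal B$ is the one for which every $F_*\mu_S$ is the centered Gaussian measure on $F\mathcal B$ with covariance operator $FSF^*$. A pair $(v^*,\nu)$ with $\nu$ a cylinder measure is a saddle point of $\Psi$ if there are $\mu_n\in\mathcal M_2(\mathcal B)$, $n\ge1$, converging to $\nu$ in the weak cylinder-measure topology,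 such that $(v^*,\mu_n)$ is a $\frac1n$-saddle point of $\Psi$ for all $n\ge1$. **Theorem.** The Gaussian cylinder measure $\mu_{\Phi^\perp(Q)}$ exists and is unique, and $(P_{Q\Phi},\mu_{\Phi^\perp(Q)})$ is a saddle point of $\Psi$; moreover the approximating sequence $(\mu_n)$ can be chosen to consist of genuine (countably additive) centered Gaussian probability measures on $\mathcal B$. If $\dim\mathcal B<\infty$, there is a unique genuine centered Gaussian measure $\mu_{\Phi^\perp(Q)}$ on $\mathcal B$ with covariance $\Phi^\perp(Q)$, and $(P_{Q\Phi},\mu_{\Phi^\perp(Q)})$ is an exact saddle point: $\Psi(P_{Q\Phi},\mu)\le\Psi(P_{Q\Phi},\mu_{\Phi^\perp(Q)})\le\Psi(v,\mu_{\Phi^\perp(Q)})$ for all $v\in L(\Phi,\mathcal B)$ and $\mu\in\mathcal M_2(\mathcal B)$. -/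

import Mathlib

open MeasureTheory ProbabilityTheory Filter Topology
open scoped ENNReal

/-! ### Cylinder measures -/

/-- A continuous linear finite-rank projection (idempotent, not necessarily orthogonal) of `B`. -/
structure FiniteRankProjection (B : Type*) [NormedAddCommGroup B] [NormedSpace ℝ B] where
  /-- the underlying continuous linear map -/
  toMap : B →L[ℝ] B
  idem : ∀ x, toMap (toMap x) = toMap x
  finite_rank : FiniteDimensional ℝ toMap.range

/-- A cylinder measure on `B`: a family of Borel probability measures `μ_F` on the images `F B` of
the continuous finite-rank projections `F`, such that `μ_{F₂}` is the image of `μ_{F₁}` under `G`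
whenever `F₂ = G F₁` with a continuous linear `G : F₁ B → F₂ B`. -/
@[ext]
structure CylinderMeasure (B : Type*) [NormedAddCommGroup B] [NormedSpace ℝ B]
    [MeasurableSpace B] [BorelSpace B] where
  /-- the image measure `F_* μ` on `F B` -/
  image : ∀ F : FiniteRankProjection B, ProbabilityMeasure F.toMap.range
  consistent : ∀ (F₁ F₂ : FiniteRankProjection B) (G : F₁.toMap.range →L[ℝ] F₂.toMap.range),
    (∀ x, G (F₁.toMap.rangeRestrict x) = F₂.toMap.rangeRestrict x) →
      image F₂ = (image F₁).map G.continuous.measurable.aemeasurable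

/-- The cylinder measure of a genuine Borel probability measure: its images under all `F`. -/
noncomputable def CylinderMeasure.ofMeasure {B : Type*} [NormedAddCommGroup B] [NormedSpace ℝ B]
    [MeasurableSpace B] [BorelSpace B] (μ : ProbabilityMeasure B) : CylinderMeasure B where
  image F := μ.map F.toMap.rangeRestrict.continuous.measurable.aemeasurable
  consistent F₁ F₂ G h := by
    apply Subtype.ext
    simp only [ProbabilityMeasure.map, ProbabilityMeasure.coe_mk]
    rw [Measure.map_map G.continuous.measurable F₁.toMap.rangeRestrict.continuous.measurable]
    congr 1
    funext x
    exact (h x).symm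

/-- Convergence of a sequence in the weak cylinder measure topology: for every `F`, the images
under `F` converge weakly. -/
def WeakCylinderTendsto {B : Type*} [NormedAddCommGroup B] [NormedSpace ℝ B]
    [MeasurableSpace B] [BorelSpace B] (μ : ℕ → CylinderMeasure B) (ν : CylinderMeasure B) : Prop :=
  ∀ F : FiniteRankProjection B, Tendsto (fun n => (μ n).image F) atTop (𝓝 (ν.image F))

/-- `μ` is a centered Gaussian measure on `V` with covariance form `c` on the dual of `V`. -/
structure IsCenteredGaussian {V : Type*} [NormedAddCommGroup V] [NormedSpace ℝ V]
    [MeasurableSpace V] (μ : Measure V) (c : StrongDual ℝ V → StrongDual ℝ V → ℝ) : Prop where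
  gaussian : IsGaussian μ
  centered : ∀ f : StrongDual ℝ V, ∫ x, f x ∂μ = 0
  covariance : ∀ f g : StrongDual ℝ V, ∫ x, f x * g x ∂μ = c f g

/-! Throughout, `J : E ≃L[ℝ] StrongDual ℝ B` exhibits `E` as a realization `B*` of the topological
dual of `B`; the dual pairing is `[φ, u] = J φ u`. -/

/-- The bilinear form `(f, g) ↦ [f, S g]` of an operator `S : B* → B`. -/
noncomputable def covForm {B E : Type*} [NormedAddCommGroup B] [NormedSpace ℝ B]
    [NormedAddCommGroup E] [NormedSpace ℝ E] (J : E ≃L[ℝ] StrongDual ℝ B) (S : E →L[ℝ] B)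
    (f g : StrongDual ℝ B) : ℝ := f (S (J.symm g))

/-- `ν` is the centered Gaussian cylinder measure with covariance operator `S : B* → B`: each image
`F_* ν` is centered Gaussian on `F B`, with covariance operator `F S F^*`. -/
def CylinderMeasure.IsGaussianWith {B E : Type*} [NormedAddCommGroup B] [NormedSpace ℝ B]
    [MeasurableSpace B] [BorelSpace B] [NormedAddCommGroup E] [NormedSpace ℝ E]
    (J : E ≃L[ℝ] StrongDual ℝ B) (S : E →L[ℝ] B) (ν : CylinderMeasure B) : Prop :=
  ∀ F : FiniteRankProjection B, IsCenteredGaussian (ν.image F : Measure F.toMap.range)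
    (fun f g => covForm J S (f ∘L F.toMap.rangeRestrict) (g ∘L F.toMap.rangeRestrict))

/-! ### The shorted operator -/

/-- `T : B* → B` is the short `Φ^⊥(Q)` of `Q`: the symmetric operator with quadratic form
`[s, T s] = inf {[s + t, Q (s + t)] : t ∈ Φ}`. -/
structure IsShort {B E : Type*} [NormedAddCommGroup B] [NormedSpace ℝ B]
    [NormedAddCommGroup E] [NormedSpace ℝ E] (J : E ≃L[ℝ] StrongDual ℝ B)
    (Q : E →L[ℝ] B) (Φ : Submodule ℝ E) (T : E →L[ℝ] B) : Prop where
  symm : ∀ s t : E, J s (T t) = J t (T s)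
  isGLB : ∀ s : E, IsGLB {r : ℝ | ∃ t ∈ Φ, r = J (s + t) (Q (s + t))} (J s (T s))

/-! ### The scaled game -/

/-- `L(Φ, B)`: the maps `B → B` that are measurable from the σ-algebra `σ(Φ)` generated by the
functions `u ↦ [φ i, u]` to the Borel σ-algebra. -/
def infoStrategies {B E : Type*} [NormedAddCommGroup B] [NormedSpace ℝ B]
    [mB : MeasurableSpace B] [NormedAddCommGroup E] [NormedSpace ℝ E]
    (J : E ≃L[ℝ] StrongDual ℝ B) {m : ℕ} (φ : Fin m → E) : Set (B → B) :=
  {v | @Measurable B B (⨆ i, (borel ℝ).comap (fun u => J (φ i) u)) mB v}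

/-- `∫ ‖x‖² dμ(x)`, as an extended nonnegative number. -/
noncomputable def secondMoment {B : Type*} [NormedAddCommGroup B] [MeasurableSpace B]
    (μ : ProbabilityMeasure B) : ℝ≥0∞ := ∫⁻ x, ‖x‖ₑ ^ 2 ∂(μ : Measure B)

/-- The probability measures with finite second moment, without the point mass at `0`, for which
the ratio defining the game would be `0 / 0`. -/
def gameMeasures (B : Type*) [NormedAddCommGroup B] [MeasurableSpace B] :
    Set (ProbabilityMeasure B) := {μ | secondMoment μ ≠ 0 ∧ secondMoment μ ≠ ∞}

/-- The scaled saddle function `Ψ(v, μ) = ∫ ‖x - v x‖² dμ / ∫ ‖x‖² dμ`, with value `∞` when the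
numerator is infinite. -/
noncomputable def scaledLoss {B : Type*} [NormedAddCommGroup B] [MeasurableSpace B]
    (v : B → B) (μ : ProbabilityMeasure B) : ℝ≥0∞ :=
  (∫⁻ x, ‖x - v x‖ₑ ^ 2 ∂(μ : Measure B)) / secondMoment μ

/-- `(v, μ)` is an `ε`-saddle point of `Ψ` (a saddle point if `ε = 0`). -/
structure IsEpsSaddle {B E : Type*} [NormedAddCommGroup B] [NormedSpace ℝ B]
    [MeasurableSpace B] [NormedAddCommGroup E] [NormedSpace ℝ E]
    (J : E ≃L[ℝ] StrongDual ℝ B) {m : ℕ} (φ : Fin m → E) (ε : ℝ≥0∞)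
    (v : B → B) (μ : ProbabilityMeasure B) : Prop where
  strategy_mem : v ∈ infoStrategies J φ
  measure_mem : μ ∈ gameMeasures B
  measure_optimal : ∀ μ' ∈ gameMeasures B, scaledLoss v μ' ≤ scaledLoss v μ + ε
  strategy_optimal : ∀ v' ∈ infoStrategies J φ, scaledLoss v μ ≤ scaledLoss v' μ + ε

/-- The measures `μ 1, μ 2, …` converge to `ν` in the weak cylinder measure topology, and
`(v, μ n)` is a `1/n`-saddle point for every `n ≥ 1`. -/
structure IsSaddleApproximation {B E : Type*} [NormedAddCommGroup B] [NormedSpace ℝ B]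
    [MeasurableSpace B] [BorelSpace B] [NormedAddCommGroup E] [NormedSpace ℝ E]
    (J : E ≃L[ℝ] StrongDual ℝ B) {m : ℕ} (φ : Fin m → E)
    (v : B → B) (ν : CylinderMeasure B) (μ : ℕ → ProbabilityMeasure B) : Prop where
  tendsto : WeakCylinderTendsto (fun n => CylinderMeasure.ofMeasure (μ n)) ν
  saddle : ∀ n : ℕ, 1 ≤ n → IsEpsSaddle J φ ((n : ℝ≥0∞)⁻¹) v (μ n)

/-- `(v, ν)` with a cylinder measure `ν` is a saddle point of `Ψ`. -/
def IsCylinderSaddle {B E : Type*} [NormedAddCommGroup B] [NormedSpace ℝ B]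
    [MeasurableSpace B] [BorelSpace B] [NormedAddCommGroup E] [NormedSpace ℝ E]
    (J : E ≃L[ℝ] StrongDual ℝ B) {m : ℕ} (φ : Fin m → E)
    (v : B → B) (ν : CylinderMeasure B) : Prop :=
  ∃ μ : ℕ → ProbabilityMeasure B, IsSaddleApproximation J φ v ν μ

/-- The span `Φ` of the measurement functionals. -/
abbrev infoSpan {E : Type*} [NormedAddCommGroup E] [NormedSpace ℝ E] {m : ℕ} (φ : Fin m → E) :
    Submodule ℝ E := Submodule.span ℝ (Set.range φ)

/-- The orthogonal projection `P_{QΦ}` of the Hilbert space `B` onto `QΦ`. -/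
noncomputable def gambletProjection {B E : Type*} [NormedAddCommGroup B] [InnerProductSpace ℝ B]
    [NormedAddCommGroup E] [NormedSpace ℝ E] (Q : E →L[ℝ] B) {m : ℕ} (φ : Fin m → E) :
    B →L[ℝ] B :=
  haveI : FiniteDimensional ℝ (infoSpan φ) := FiniteDimensional.span_of_finite ℝ (Set.finite_range φ)
  haveI : FiniteDimensional ℝ ((infoSpan φ).map Q.toLinearMap) := inferInstance
  ((infoSpan φ).map Q.toLinearMap).starProjection

/-! ### Centered Gaussian measures -/

/-! Put `K = (QΦ)ᗮ`. Since `[s, Q s] = ‖Q s‖²`, the short of `Q` is the projection onto `K` composed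
with `Q` (`isShort_starProjection_comp`). Under the Riesz identification its Gaussian is therefore
the standard Gaussian of `K`, which is only cylindrical when `K` is infinite-dimensional.

Let `U ≤ K` be nonzero and finite-dimensional, carrying its standard Gaussian. All measurements
vanish on `U`, so every strategy is constant there, and no constant beats the mean `0`. The
projection onto `QΦ` is `0` on `U` and so has loss exactly `1`. Against any other measure its loss
is at most `1`, because `x - P x` is itself a projection of `x`. This is an exact saddle point
(`isEpsSaddle_zero_gaussianOn`).

The dimension hypothesis gives `K ≠ ⊥`. In finite dimensions take `U = K`. In general exhaust `K` by
finite-dimensional `U n`: the projections converge pointwise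
(`exists_finiteDimensional_tendsto_starProjection`), hence so do the covariances, and hence the
finite-rank images converge weakly (`tendsto_of_isCenteredGaussian`). The `1/n` slack is never
needed. -/

namespace IsCenteredGaussian

lemma congr {V : Type*} [NormedAddCommGroup V] [NormedSpace ℝ V] [MeasurableSpace V]
    {μ : Measure V} {c c' : StrongDual ℝ V → StrongDual ℝ V → ℝ} (h : IsCenteredGaussian μ c)
    (hc : ∀ f g, c f g = c' f g) : IsCenteredGaussian μ c' where
  gaussian := h.gaussian
  centered := h.centered
  covariance f g := (h.covariance f g).trans (hc f g)

section Normed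

variable {V W : Type*} [NormedAddCommGroup V] [NormedSpace ℝ V] [MeasurableSpace V] [BorelSpace V]
  [NormedAddCommGroup W] [NormedSpace ℝ W] [MeasurableSpace W] [BorelSpace W]
  {μ ν : Measure V} {c : StrongDual ℝ V → StrongDual ℝ V → ℝ}

lemma charFunDual_eq (h : IsCenteredGaussian μ c) (f : StrongDual ℝ V) :
    charFunDual μ f = Complex.exp (-(c f f : ℂ) / 2) := by
  have := h.gaussian
  rw [IsGaussian.charFunDual_eq, integral_complex_ofReal, h.centered,
    variance_of_integral_eq_zero f.continuous.aemeasurable (h.centered f)]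
  simp only [pow_two, h.covariance]
  congr 1
  push_cast
  ring

lemma map (h : IsCenteredGaussian μ c) (L : V →L[ℝ] W) :
    IsCenteredGaussian (μ.map L) (fun f g => c (f ∘L L) (g ∘L L)) where
  gaussian := by
    have := h.gaussian
    infer_instance
  centered f := by
    rw [integral_map L.continuous.measurable.aemeasurable f.continuous.aestronglyMeasurable]
    exact h.centered (f ∘L L)
  covariance f g := by
    rw [integral_map L.continuous.measurable.aemeasurable
      (by fun_prop : Continuous fun x => f x * g x).aestronglyMeasurable]
    exact h.covariance (f ∘L L) (g ∘L L)

lemma ext [CompleteSpace V] [SecondCountableTopology V] (hμ : IsCenteredGaussian μ c)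
    (hν : IsCenteredGaussian ν c) : μ = ν := by
  have := hμ.gaussian
  have := hν.gaussian
  apply Measure.ext_of_charFunDual
  ext f
  rw [hμ.charFunDual_eq, hν.charFunDual_eq]

lemma integral_id_eq_zero [CompleteSpace V] [SecondCountableTopology V]
    (h : IsCenteredGaussian μ c) : ∫ x, x ∂μ = 0 := by
  have := h.gaussian
  have hi : Integrable (fun x : V => x) μ := IsGaussian.integrable_id
  refine (SeparatingDual.eq_zero_iff_forall_dual_eq_zero (R := ℝ) _).2 fun f => ?_
  rw [← ContinuousLinearMap.integral_comp_comm f hi]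
  exact h.centered f

end Normed

lemma charFun_eq {V : Type*} [NormedAddCommGroup V] [InnerProductSpace ℝ V] [MeasurableSpace V]
    [BorelSpace V] {μ : Measure V} {c : StrongDual ℝ V → StrongDual ℝ V → ℝ}
    (h : IsCenteredGaussian μ c) (t : V) :
    charFun μ t = Complex.exp (-(c (innerSL ℝ t) (innerSL ℝ t) : ℂ) / 2) := by
  rw [charFun_eq_charFunDual_toDualMap, h.charFunDual_eq]
  rfl

end IsCenteredGaussian

/-- Centered Gaussian measures converge weakly when their covariance forms converge. -/
lemma tendsto_of_isCenteredGaussian {V : Type*} [NormedAddCommGroup V] [InnerProductSpace ℝ V]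
    [FiniteDimensional ℝ V] [MeasurableSpace V] [BorelSpace V]
    {μ : ℕ → ProbabilityMeasure V} {ν : ProbabilityMeasure V}
    {c : ℕ → StrongDual ℝ V → StrongDual ℝ V → ℝ} {c' : StrongDual ℝ V → StrongDual ℝ V → ℝ}
    (hμ : ∀ n, IsCenteredGaussian (μ n : Measure V) (c n))
    (hν : IsCenteredGaussian (ν : Measure V) c')
    (hc : ∀ f, Tendsto (fun n => c n f f) atTop (𝓝 (c' f f))) :
    Tendsto μ atTop (𝓝 ν) := by
  refine ProbabilityMeasure.tendsto_iff_tendsto_charFun.2 fun t => ?_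
  simp only [(hμ _).charFun_eq, hν.charFun_eq]
  have h := (Complex.continuous_ofReal.tendsto _).comp (hc (innerSL ℝ t))
  exact (Complex.continuous_exp.tendsto _).comp (h.neg.div_const 2)

/-! ### The standard Gaussian measure on a finite-dimensional subspace -/

section GaussianOn

variable {B : Type*} [NormedAddCommGroup B] [InnerProductSpace ℝ B] [MeasurableSpace B]
  [BorelSpace B]

lemma isCenteredGaussian_stdGaussian {V : Type*} [NormedAddCommGroup V] [InnerProductSpace ℝ V]
    [FiniteDimensional ℝ V] [MeasurableSpace V] [BorelSpace V] :
    IsCenteredGaussian (stdGaussian V)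
      (fun f g => inner ℝ ((InnerProductSpace.toDual ℝ V).symm f)
        ((InnerProductSpace.toDual ℝ V).symm g)) where
  gaussian := inferInstance
  centered := integral_strongDual_stdGaussian
  covariance f g := by
    have h := covarianceBilin_apply_eq_cov (μ := stdGaussian V) IsGaussian.memLp_two_id
      ((InnerProductSpace.toDual ℝ V).symm f) ((InnerProductSpace.toDual ℝ V).symm g)
    rw [covarianceBilin_stdGaussian] at h
    simp only [InnerProductSpace.toDual_symm_apply] at h
    rw [covariance_eq_sub (IsGaussian.memLp_dual _ f 2 (by simp))
      (IsGaussian.memLp_dual _ g 2 (by simp)), integral_strongDual_stdGaussian] at h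
    simp only [zero_mul, sub_zero] at h
    exact h.symm

/-- The standard Gaussian measure of a finite-dimensional subspace, as a measure on the whole
space. -/
noncomputable def gaussianOn (U : Submodule ℝ B) [FiniteDimensional ℝ U] : Measure B :=
  (stdGaussian U).map U.subtypeL

variable (U : Submodule ℝ B) [FiniteDimensional ℝ U]

instance isGaussian_gaussianOn : IsGaussian (gaussianOn U) := by
  unfold gaussianOn
  infer_instance

/-- The adjoint of the inclusion of `U` is the orthogonal projection onto `U`, so pushing the
identity covariance forward along the inclusion yields `U.starProjection`. -/
lemma isCenteredGaussian_gaussianOn [CompleteSpace B] :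
    IsCenteredGaussian (gaussianOn U)
      (fun f g => f (U.starProjection ((InnerProductSpace.toDual ℝ B).symm g))) := by
  refine (isCenteredGaussian_stdGaussian.map U.subtypeL).congr fun f g => ?_
  have hg : (InnerProductSpace.toDual ℝ U).symm (g ∘L U.subtypeL) =
      U.orthogonalProjectionOnto ((InnerProductSpace.toDual ℝ B).symm g) := by
    refine ext_inner_right ℝ fun x => ?_
    simp [InnerProductSpace.toDual_symm_apply]
  rw [hg, InnerProductSpace.toDual_symm_apply]
  rfl

lemma ae_mem_gaussianOn : ∀ᵐ x ∂gaussianOn U, x ∈ U := by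
  unfold gaussianOn
  exact (ae_map_iff U.subtypeL.continuous.measurable.aemeasurable
    U.closed_of_finiteDimensional.measurableSet).2 (ae_of_all _ fun x => x.2)

end GaussianOn

lemma lintegral_enorm_sub_sq_eq_ofReal {B : Type*} [NormedAddCommGroup B] [MeasurableSpace B]
    {μ : Measure B} [IsProbabilityMeasure μ]
    (hμ : MemLp id 2 μ) (c : B) :
    ∫⁻ x, ‖x - c‖ₑ ^ 2 ∂μ = ENNReal.ofReal (∫ x, ‖x - c‖ ^ 2 ∂μ) := by
  have hi : Integrable (fun x => ‖x - c‖ ^ 2) μ :=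
    (hμ.sub (memLp_const c)).integrable_norm_pow (by simp)
  rw [ofReal_integral_eq_lintegral_ofReal hi (ae_of_all _ fun x => by positivity)]
  refine lintegral_congr fun x => ?_
  rw [ENNReal.ofReal_pow (norm_nonneg _), ofReal_norm]

/-- The mean minimizes the mean squared distance. -/
lemma lintegral_enorm_sq_le_of_integral_eq_zero {B : Type*} [NormedAddCommGroup B]
    [InnerProductSpace ℝ B] [CompleteSpace B] [MeasurableSpace B] {μ : Measure B} [IsProbabilityMeasure μ]
    (hμ : MemLp id 2 μ) (h0 : ∫ x, x ∂μ = 0) (c : B) :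
    ∫⁻ x, ‖x‖ₑ ^ 2 ∂μ ≤ ∫⁻ x, ‖x - c‖ₑ ^ 2 ∂μ := by
  have h1 := lintegral_enorm_sub_sq_eq_ofReal hμ 0
  simp only [sub_zero] at h1
  rw [h1, lintegral_enorm_sub_sq_eq_ofReal hμ c]
  refine ENNReal.ofReal_le_ofReal ?_
  have hx : Integrable (fun x : B => x) μ := hμ.integrable (by norm_num)
  have hi : Integrable (fun x : B => ‖x‖ ^ 2) μ := hμ.integrable_norm_pow (by simp)
  have hc : Integrable (fun x : B => 2 * inner ℝ c x) μ := (hx.const_inner c).const_mul 2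
  have hexp : ∀ x : B, ‖x - c‖ ^ 2 = ‖x‖ ^ 2 - 2 * inner ℝ c x + ‖c‖ ^ 2 := fun x => by
    rw [norm_sub_sq_real, real_inner_comm]
  simp only [hexp]
  have hsum : ∫ x, (‖x‖ ^ 2 - 2 * inner ℝ c x + ‖c‖ ^ 2) ∂μ = ∫ x, ‖x‖ ^ 2 ∂μ + ‖c‖ ^ 2 := by
    have hic : Integrable (fun x : B => ‖x‖ ^ 2 - 2 * inner ℝ c x) μ := hi.sub hc
    rw [integral_add hic (integrable_const _), integral_sub hi hc, integral_const_mul,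
      integral_inner hx, h0]
    simp
  rw [hsum]
  exact le_add_of_nonneg_right (sq_nonneg _)

/-! ### The information σ-algebra -/

section Information

variable {B E : Type*} [NormedAddCommGroup B] [NormedSpace ℝ B] [MeasurableSpace B] [BorelSpace B]
  [NormedAddCommGroup E] [NormedSpace ℝ E] (J : E ≃L[ℝ] StrongDual ℝ B) {m : ℕ} (φ : Fin m → E)

/-- A strategy takes equal values at points that the measurements do not distinguish. -/
lemma infoStrategies_eq_of_forall_eq {v : B → B} (hv : v ∈ infoStrategies J φ) {x y : B}
    (hxy : ∀ i, J (φ i) x = J (φ i) y) : v x = v y := by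
  -- The sets that do not separate `x` from `y` form a σ-algebra containing the generators, hence
  -- also the preimage of `{v x}` under `v`.
  let mS : MeasurableSpace B :=
    { MeasurableSet' := fun s => x ∈ s ↔ y ∈ s
      measurableSet_empty := Iff.rfl
      measurableSet_compl := fun s h => not_congr h
      measurableSet_iUnion := fun s h => by simp only [Set.mem_iUnion, h] }
  have hle : (⨆ i, (borel ℝ).comap (fun u => J (φ i) u)) ≤ mS := by
    refine iSup_le fun i => ?_
    rintro _ ⟨t, -, rfl⟩
    change J (φ i) x ∈ t ↔ J (φ i) y ∈ t
    rw [hxy i]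
  have h : v x ∈ ({v x} : Set B) ↔ v y ∈ ({v x} : Set B) :=
    hle _ (hv (measurableSet_singleton (v x)))
  exact (h.1 rfl).symm

lemma measurable_dual_of_mem_infoSpan {B E : Type*} [NormedAddCommGroup B] [NormedSpace ℝ B]
    [NormedAddCommGroup E] [NormedSpace ℝ E] (J : E ≃L[ℝ] StrongDual ℝ B) {m : ℕ}
    (φ : Fin m → E) {s : E} (hs : s ∈ infoSpan φ) :
    Measurable[⨆ i, (borel ℝ).comap (fun u => J (φ i) u)] (fun u => J s u) := by
  induction hs using Submodule.span_induction with
  | mem x h =>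
    obtain ⟨i, rfl⟩ := h
    rw [measurable_iff_comap_le, BorelSpace.measurable_eq (α := ℝ)]
    exact le_iSup (fun i => (borel ℝ).comap (fun u => J (φ i) u)) i
  | zero => simp
  | add x y _ _ hx hy =>
    simp only [map_add, _root_.add_apply]
    exact hx.add hy
  | smul a x _ hx => simpa using hx.const_mul a

end Information

section Game

variable {B E : Type*} [NormedAddCommGroup B] [InnerProductSpace ℝ B]
  [NormedAddCommGroup E] [NormedSpace ℝ E] {J : E ≃L[ℝ] StrongDual ℝ B} {Q : E ≃L[ℝ] B}

lemma pairing_eq_inner (hQ : ∀ u₁ u₂ : B, inner ℝ u₁ u₂ = J (Q.symm u₁) u₂) (s : E) (u : B) :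
    J s u = inner ℝ (Q s) u := by
  rw [hQ, Q.symm_apply_apply]

/-- Compatibility of `Q` with the inner product lets `E`, `J` and `Q` be replaced by the Riesz
isomorphism in covariance computations. -/
lemma apply_symm_eq_toDual_symm [CompleteSpace B]
    (hQ : ∀ u₁ u₂ : B, inner ℝ u₁ u₂ = J (Q.symm u₁) u₂) (g : StrongDual ℝ B) :
    Q (J.symm g) = (InnerProductSpace.toDual ℝ B).symm g := by
  refine ext_inner_right ℝ fun x => ?_
  rw [← pairing_eq_inner hQ, J.apply_symm_apply, InnerProductSpace.toDual_symm_apply]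

/-! ### The shorted operator -/

/-- Polarization: a symmetric operator is determined by its quadratic form. -/
lemma IsShort.unique {Φ : Submodule ℝ E} {T T' : E →L[ℝ] B} (h : IsShort J (Q : E →L[ℝ] B) Φ T)
    (h' : IsShort J (Q : E →L[ℝ] B) Φ T') : T = T' := by
  have hq : ∀ s, J s (T s) = J s (T' s) := fun s => (h.isGLB s).unique (h'.isGLB s)
  ext t
  refine (SeparatingDual.eq_iff_forall_dual_eq (R := ℝ)).2 fun f => ?_
  obtain ⟨s, rfl⟩ := J.surjective f
  have h1 := hq (s + t)
  simp only [map_add, _root_.add_apply] at h1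
  linarith [hq s, hq t, h.symm s t, h'.symm s t]

/-- The infimum of `‖Q s + Q t‖²` over `t ∈ Φ` is the squared distance from `Q s` to `W`, attained
when `Q t` is minus the projection of `Q s` onto `W`. -/
lemma isShort_starProjection_comp (hQ : ∀ u₁ u₂ : B, inner ℝ u₁ u₂ = J (Q.symm u₁) u₂)
    {Φ : Submodule ℝ E} {W : Submodule ℝ B} [W.HasOrthogonalProjection]
    (hW : Φ.map (Q : E →L[ℝ] B).toLinearMap = W) :
    IsShort J (Q : E →L[ℝ] B) Φ (Wᗮ.starProjection ∘L (Q : E →L[ℝ] B)) := by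
  have hsa : ∀ x y : B, inner ℝ x (Wᗮ.starProjection y) = inner ℝ (Wᗮ.starProjection x) y :=
    fun x y => (Submodule.inner_starProjection_left_eq_right _ x y).symm
  have hsq : ∀ x : B, inner ℝ x (Wᗮ.starProjection x) = ‖Wᗮ.starProjection x‖ ^ 2 := fun x => by
    rw [← real_inner_self_eq_norm_sq, ← hsa,
      Submodule.starProjection_eq_self_iff.2 (Submodule.starProjection_apply_mem _ x)]
  constructor
  · intro s t
    simp only [pairing_eq_inner hQ, ContinuousLinearMap.comp_apply, hsa,
      ContinuousLinearEquiv.coe_coe]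
    rw [real_inner_comm, hsa]
  · intro s
    refine IsLeast.isGLB ⟨?_, ?_⟩
    · obtain ⟨t, ht, hts⟩ := Submodule.mem_map.1
        (hW.symm.le (W.starProjection_apply_mem (Q s)))
      refine ⟨-t, Φ.neg_mem ht, ?_⟩
      have hQt : Q (s + -t) = Wᗮ.starProjection (Q s) := by
        rw [Submodule.starProjection_orthogonal_val, map_add, map_neg, ← sub_eq_add_neg]
        exact congrArg _ hts
      simp only [pairing_eq_inner hQ, ContinuousLinearMap.comp_apply,
        ContinuousLinearEquiv.coe_coe, hsq, hQt, real_inner_self_eq_norm_sq]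
    · rintro _ ⟨t, ht, rfl⟩
      have hP : Wᗮ.starProjection (Q (s + t)) = Wᗮ.starProjection (Q s) := by
        rw [map_add, map_add, add_eq_left, Submodule.starProjection_apply_eq_zero_iff]
        exact Submodule.le_orthogonal_orthogonal _ (hW ▸ Submodule.mem_map_of_mem ht)
      simp only [pairing_eq_inner hQ, ContinuousLinearMap.comp_apply,
        ContinuousLinearEquiv.coe_coe, hsq, real_inner_self_eq_norm_sq]
      rw [← hP]
      exact pow_le_pow_left₀ (norm_nonneg _) (Submodule.norm_starProjection_apply_le _ _) 2

/-! ### Saddle points -/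

/-- The span `QΦ` of the images of the measurement functionals. -/
abbrev gambletSpan (Q : E →L[ℝ] B) {m : ℕ} (φ : Fin m → E) : Submodule ℝ B :=
  (infoSpan φ).map Q.toLinearMap

instance finiteDimensional_gambletSpan (Q : E →L[ℝ] B) {m : ℕ} (φ : Fin m → E) :
    FiniteDimensional ℝ (gambletSpan Q φ) :=
  haveI : FiniteDimensional ℝ (infoSpan φ) :=
    FiniteDimensional.span_of_finite ℝ (Set.finite_range φ)
  inferInstance

lemma gambletProjection_eq (Q : E →L[ℝ] B) {m : ℕ} (φ : Fin m → E) :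
    gambletProjection Q φ = (gambletSpan Q φ).starProjection := rfl

variable {m : ℕ} {φ : Fin m → E} [MeasurableSpace B] [BorelSpace B]

/-- The coordinates of the projection in an orthonormal basis of `QΦ` are pairings with elements of
`Φ`. -/
lemma gambletProjection_mem_infoStrategies [SecondCountableTopology B]
    (hQ : ∀ u₁ u₂ : B, inner ℝ u₁ u₂ = J (Q.symm u₁) u₂) :
    ⇑(gambletProjection (Q : E →L[ℝ] B) φ) ∈ infoStrategies J φ := by
  rw [gambletProjection_eq]
  have hexp : ⇑(gambletSpan (Q : E →L[ℝ] B) φ).starProjection = fun x => ∑ i,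
      inner ℝ (stdOrthonormalBasis ℝ (gambletSpan (Q : E →L[ℝ] B) φ) i : B) x •
        (stdOrthonormalBasis ℝ (gambletSpan (Q : E →L[ℝ] B) φ) i : B) := by
    ext x
    rw [(stdOrthonormalBasis ℝ (gambletSpan (Q : E →L[ℝ] B) φ)).starProjection_eq_sum_rankOne]
    simp
  rw [infoStrategies, Set.mem_ofPred_eq, hexp]
  refine Finset.measurable_sum _ fun i _ => Measurable.smul_const ?_ _
  obtain ⟨t, ht, hti⟩ :=
    Submodule.mem_map.1 (stdOrthonormalBasis ℝ (gambletSpan (Q : E →L[ℝ] B) φ) i).2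
  have h := measurable_dual_of_mem_infoSpan J φ ht
  simp only [pairing_eq_inner hQ] at h
  rw [← hti]
  exact h

lemma IsEpsSaddle.mono {B E : Type*} [NormedAddCommGroup B] [NormedSpace ℝ B]
    [MeasurableSpace B] [NormedAddCommGroup E] [NormedSpace ℝ E] {J : E ≃L[ℝ] StrongDual ℝ B}
    {m : ℕ} {φ : Fin m → E} {ε ε' : ℝ≥0∞} (hε : ε ≤ ε') {v : B → B} {μ : ProbabilityMeasure B}
    (h : IsEpsSaddle J φ ε v μ) : IsEpsSaddle J φ ε' v μ where
  strategy_mem := h.strategy_mem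
  measure_mem := h.measure_mem
  measure_optimal μ' hμ' := (h.measure_optimal μ' hμ').trans (by gcongr)
  strategy_optimal v' hv' := (h.strategy_optimal v' hv').trans (by gcongr)

/-- A vanishing second moment would concentrate the measure at `0`, but `⟨a, ·⟩` has variance `‖a‖²`
for `a ∈ U`. -/
lemma secondMoment_gaussianOn_ne_zero [CompleteSpace B] {U : Submodule ℝ B}
    [FiniteDimensional ℝ U] (hU : U ≠ ⊥) : ∫⁻ x, ‖x‖ₑ ^ 2 ∂gaussianOn U ≠ 0 := by
  intro h0
  obtain ⟨a, haU, ha⟩ := U.exists_mem_ne_zero_of_ne_bot hU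
  have hae : ∀ᵐ x ∂gaussianOn U, x = 0 := by
    rw [lintegral_eq_zero_iff (by fun_prop)] at h0
    filter_upwards [h0] with x hx
    simpa using hx
  have hcov := (isCenteredGaussian_gaussianOn U).covariance (innerSL ℝ a) (innerSL ℝ a)
  have hz : ∫ x, innerSL ℝ a x * innerSL ℝ a x ∂gaussianOn U = 0 := by
    rw [integral_eq_zero_of_ae]
    filter_upwards [hae] with x hx
    simp [hx]
  have hd : (InnerProductSpace.toDual ℝ B).symm (innerSL ℝ a) = a := by
    refine ext_inner_right ℝ fun x => ?_
    simp [InnerProductSpace.toDual_symm_apply]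
  rw [hz, hd, Submodule.starProjection_eq_self_iff.2 haU, innerSL_apply_apply,
    real_inner_self_eq_norm_sq] at hcov
  exact ha (by simpa using hcov.symm)

/-- Against the standard Gaussian measure of any nonzero finite-dimensional subspace orthogonal to
`QΦ`, the projection onto `QΦ` is in exact equilibrium. -/
theorem isEpsSaddle_zero_gaussianOn [CompleteSpace B] [SecondCountableTopology B]
    (hQ : ∀ u₁ u₂ : B, inner ℝ u₁ u₂ = J (Q.symm u₁) u₂) {U : Submodule ℝ B}
    [FiniteDimensional ℝ U] (hU : U ≠ ⊥) (hUW : U ≤ (gambletSpan (Q : E →L[ℝ] B) φ)ᗮ) :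
    IsEpsSaddle J φ 0 (gambletProjection (Q : E →L[ℝ] B) φ)
      (⟨gaussianOn U, inferInstance⟩ : ProbabilityMeasure B) := by
  have hL2 : MemLp id 2 (gaussianOn U) := IsGaussian.memLp_two_id
  have hmem : (⟨gaussianOn U, inferInstance⟩ : ProbabilityMeasure B) ∈ gameMeasures B := by
    refine ⟨secondMoment_gaussianOn_ne_zero hU, ?_⟩
    have h := lintegral_enorm_sub_sq_eq_ofReal hL2 0
    simp only [sub_zero] at h
    change ∫⁻ x, ‖x‖ₑ ^ 2 ∂gaussianOn U ≠ ∞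
    rw [h]
    exact ENNReal.ofReal_ne_top
  have hnum : ∫⁻ x, ‖x - gambletProjection (Q : E →L[ℝ] B) φ x‖ₑ ^ 2 ∂gaussianOn U =
      ∫⁻ x, ‖x‖ₑ ^ 2 ∂gaussianOn U := by
    refine lintegral_congr_ae ?_
    filter_upwards [ae_mem_gaussianOn U] with x hx
    rw [gambletProjection_eq, (Submodule.starProjection_apply_eq_zero_iff _).2 (hUW hx), sub_zero]
  have hone : scaledLoss (gambletProjection (Q : E →L[ℝ] B) φ)
      (⟨gaussianOn U, inferInstance⟩ : ProbabilityMeasure B) = 1 := by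
    unfold scaledLoss
    rw [ProbabilityMeasure.coe_mk, hnum]
    exact ENNReal.div_self hmem.1 hmem.2
  refine ⟨gambletProjection_mem_infoStrategies hQ, hmem, fun μ' hμ' => ?_, fun v hv => ?_⟩
  · rw [hone, add_zero]
    refine ENNReal.div_le_of_le_mul ?_
    rw [one_mul]
    refine lintegral_mono fun x => ?_
    gcongr
    rw [gambletProjection_eq, ← Submodule.starProjection_orthogonal_val,
      enorm_le_iff_norm_le]
    exact Submodule.norm_starProjection_apply_le _ _
  · rw [add_zero]
    unfold scaledLoss
    rw [ProbabilityMeasure.coe_mk, hnum]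
    refine ENNReal.div_le_div_right ?_ _
    have hv0 : ∫⁻ x, ‖x - v x‖ₑ ^ 2 ∂gaussianOn U = ∫⁻ x, ‖x - v 0‖ₑ ^ 2 ∂gaussianOn U := by
      refine lintegral_congr_ae ?_
      filter_upwards [ae_mem_gaussianOn U] with x hx
      have hvx : v x = v 0 := infoStrategies_eq_of_forall_eq J φ hv fun i => by
        rw [map_zero, pairing_eq_inner hQ]
        have hi : Q (φ i) ∈ gambletSpan (Q : E →L[ℝ] B) φ :=
          Submodule.mem_map_of_mem (Submodule.subset_span (Set.mem_range_self i))
        exact Submodule.inner_right_of_mem_orthogonal hi (hUW hx)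
      rw [hvx]
    rw [hv0]
    exact lintegral_enorm_sq_le_of_integral_eq_zero hL2
      (isCenteredGaussian_gaussianOn U).integral_id_eq_zero _

end Game

/-! ### Gaussian cylinder measures -/

section Cylinder

variable {B E : Type*} [NormedAddCommGroup B] [MeasurableSpace B] [BorelSpace B]
  [SecondCountableTopology B] [NormedAddCommGroup E] [NormedSpace ℝ E]

lemma CylinderMeasure.IsGaussianWith.unique [NormedSpace ℝ B] {J : E ≃L[ℝ] StrongDual ℝ B}
    {S : E →L[ℝ] B} {ν ν' : CylinderMeasure B} (h : ν.IsGaussianWith J S)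
    (h' : ν'.IsGaussianWith J S) : ν = ν' := by
  ext1
  funext F
  have := F.finite_rank
  have : CompleteSpace F.toMap.range := FiniteDimensional.complete ℝ _
  exact Subtype.ext ((h F).ext (h' F))

/-- Finite-dimensional Gaussian images assemble to a Gaussian cylinder measure. -/
lemma CylinderMeasure.exists_isGaussianWith [NormedSpace ℝ B] {J : E ≃L[ℝ] StrongDual ℝ B}
    {S : E →L[ℝ] B}
    (h : ∀ F : FiniteRankProjection B, ∃ μ : ProbabilityMeasure F.toMap.range,
      IsCenteredGaussian (μ : Measure F.toMap.range)
        (fun f g => covForm J S (f ∘L F.toMap.rangeRestrict) (g ∘L F.toMap.rangeRestrict))) :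
    ∃ ν : CylinderMeasure B, ν.IsGaussianWith J S := by
  choose μ hμ using h
  refine ⟨⟨μ, fun F₁ F₂ G hG => ?_⟩, hμ⟩
  have := F₂.finite_rank
  have : CompleteSpace F₂.toMap.range := FiniteDimensional.complete ℝ _
  have hG' : G ∘L F₁.toMap.rangeRestrict = F₂.toMap.rangeRestrict := by
    ext x
    exact congrArg Subtype.val (hG x)
  -- Consistency is automatic: both sides are centered Gaussian with the same covariance.
  refine Subtype.ext ((hμ F₂).ext (((hμ F₁).map G).congr fun f g => ?_))
  rw [ContinuousLinearMap.comp_assoc, ContinuousLinearMap.comp_assoc, hG']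

end Cylinder

/-! ### Finite-dimensional images and approximations of a closed subspace -/

section Projections

variable {B : Type*} [NormedAddCommGroup B] [InnerProductSpace ℝ B] [CompleteSpace B]

/-- The image under a finite-rank operator `L` of the (cylindrical) standard Gaussian of a closed
subspace `K`. -/
lemma exists_isCenteredGaussian_image [MeasurableSpace B] [BorelSpace B]
    {V : Type*} [NormedAddCommGroup V] [InnerProductSpace ℝ V] [FiniteDimensional ℝ V]
    [MeasurableSpace V] [BorelSpace V] (K : Submodule ℝ B)
    [K.HasOrthogonalProjection] (L : B →L[ℝ] V) :
    ∃ μ : ProbabilityMeasure V, IsCenteredGaussian (μ : Measure V)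
      (fun f g => f (L (K.starProjection ((InnerProductSpace.toDual ℝ B).symm (g ∘L L))))) := by
  have : CompleteSpace V := FiniteDimensional.complete ℝ V
  let M : B →L[ℝ] V := L ∘L K.starProjection
  -- This finite-dimensional space contains the Riesz vectors of all `g ∘L M`, so the projection
  -- onto it drops out of the covariance.
  let U : Submodule ℝ B := (ContinuousLinearMap.adjoint M).toLinearMap.range
  have h := (isCenteredGaussian_gaussianOn U).map M
  have := h.gaussian
  refine ⟨⟨(gaussianOn U).map M, inferInstance⟩, h.congr fun f g => ?_⟩
  have hKL : (InnerProductSpace.toDual ℝ B).symm (g ∘L M) =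
      K.starProjection ((InnerProductSpace.toDual ℝ B).symm (g ∘L L)) := by
    refine ext_inner_right ℝ fun x => ?_
    rw [Submodule.inner_starProjection_left_eq_right, InnerProductSpace.toDual_symm_apply,
      InnerProductSpace.toDual_symm_apply]
    rfl
  have hU : (InnerProductSpace.toDual ℝ B).symm (g ∘L M) ∈ U := by
    refine ⟨(InnerProductSpace.toDual ℝ V).symm g, ext_inner_right ℝ fun x => ?_⟩
    rw [ContinuousLinearMap.coe_coe, ContinuousLinearMap.adjoint_inner_left,
      InnerProductSpace.toDual_symm_apply, InnerProductSpace.toDual_symm_apply]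
    rfl
  rw [Submodule.starProjection_eq_self_iff.2 hU, hKL, ContinuousLinearMap.comp_apply,
    ContinuousLinearMap.comp_apply,
    Submodule.starProjection_eq_self_iff.2 (K.starProjection_apply_mem _)]

/-- The orthogonal projection onto a closed subspace of a separable Hilbert space is the pointwise
limit of projections onto nonzero finite-dimensional subspaces. -/
lemma exists_finiteDimensional_tendsto_starProjection [TopologicalSpace.SeparableSpace B]
    (K : Submodule ℝ B) [K.HasOrthogonalProjection] (hK : K ≠ ⊥) :
    ∃ (U : ℕ → Submodule ℝ B) (_ : ∀ n, FiniteDimensional ℝ (U n)),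
      (∀ n, U n ≠ ⊥) ∧ (∀ n, U n ≤ K) ∧
      ∀ x, Tendsto (fun n => (U n).starProjection x) atTop (𝓝 (K.starProjection x)) := by
  obtain ⟨a, haK, ha⟩ := K.exists_mem_ne_zero_of_ne_bot hK
  let d := TopologicalSpace.denseSeq B
  -- The projections of a dense sequence are dense in `K`; the vector `a` keeps every span nonzero.
  let S : ℕ → Set B := fun n => insert a ((fun i => K.starProjection (d i)) '' Set.Iic n)
  let U : ℕ → Submodule ℝ B := fun n => Submodule.span ℝ (S n)
  have hfin : ∀ n, FiniteDimensional ℝ (U n) := fun n =>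
    FiniteDimensional.span_of_finite ℝ (((Set.finite_Iic n).image _).insert a)
  have hUK : ∀ n, U n ≤ K := fun n => by
    refine Submodule.span_le.2 (Set.insert_subset haK ?_)
    rintro _ ⟨i, -, rfl⟩
    exact K.starProjection_apply_mem _
  have hmono : Monotone U := fun i j hij =>
    Submodule.span_mono (Set.insert_subset_insert (Set.image_mono (Set.Iic_subset_Iic.2 hij)))
  have hclosure : (⨆ n, U n).topologicalClosure = K := by
    refine le_antisymm (Submodule.topologicalClosure_minimal _ (iSup_le hUK)
      (K.orthogonal_orthogonal ▸ Kᗮ.isClosed_orthogonal)) fun x hx => ?_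
    rw [← Submodule.starProjection_eq_self_iff.2 hx]
    refine map_mem_closure K.starProjection.continuous
      (TopologicalSpace.denseRange_denseSeq B x) ?_
    rintro _ ⟨i, rfl⟩
    exact Submodule.mem_iSup_of_mem i
      (Submodule.subset_span (Set.mem_insert_of_mem _ ⟨i, Set.mem_Iic.2 le_rfl, rfl⟩))
  refine ⟨U, hfin, fun n => ?_, hUK, fun x => ?_⟩
  · exact (Submodule.ne_bot_iff _).2 ⟨a, Submodule.subset_span (Set.mem_insert _ _), ha⟩
  · have h := Submodule.starProjection_tendsto_closure_iSup U hmono x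
    simpa only [hclosure] using h

end Projections

/-- A finite-dimensional subspace with trivial orthogonal complement is everything, which would
bound the rank of `B` by `dim Φ`. -/
lemma orthogonal_gambletSpan_ne_bot {B E : Type*} [NormedAddCommGroup B] [InnerProductSpace ℝ B]
    [NormedAddCommGroup E] [NormedSpace ℝ E] (Q : E →L[ℝ] B) {m : ℕ} (φ : Fin m → E)
    (hdim : (Module.finrank ℝ (infoSpan φ) : Cardinal) < Module.rank ℝ B) :
    (gambletSpan Q φ)ᗮ ≠ ⊥ := by
  intro h
  have : FiniteDimensional ℝ (infoSpan φ) :=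
    FiniteDimensional.span_of_finite ℝ (Set.finite_range φ)
  have htop : gambletSpan Q φ = ⊤ := (Submodule.orthogonal_eq_bot_iff).1 h
  have hle : Module.finrank ℝ (gambletSpan Q φ) ≤ Module.finrank ℝ (infoSpan φ) :=
    Submodule.finrank_map_le _ _
  have hr : Module.rank ℝ B = Module.finrank ℝ (gambletSpan Q φ) := by
    rw [Module.finrank_eq_rank, htop, rank_top]
  rw [hr] at hdim
  exact absurd (Nat.cast_lt.1 hdim) (not_lt.2 hle)

theorem theorem4p9
    {B E : Type*} [NormedAddCommGroup B] [InnerProductSpace ℝ B] [CompleteSpace B]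
    [TopologicalSpace.SeparableSpace B] [MeasurableSpace B] [BorelSpace B]
    [NormedAddCommGroup E] [NormedSpace ℝ E]
    -- `E` is a realization of the dual of `B`, with pairing `[φ, u] = J φ u`
    (J : E ≃L[ℝ] StrongDual ℝ B) (Q : E ≃L[ℝ] B)
    -- the inner product of `B` is `⟨u₁, u₂⟩ = [Q⁻¹ u₁, u₂]`
    (hQ : ∀ u₁ u₂ : B, inner ℝ u₁ u₂ = J (Q.symm u₁) u₂)
    {m : ℕ} (φ : Fin m → E)
    (hdim : (Module.finrank ℝ (infoSpan φ) : Cardinal) < Module.rank ℝ B) :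
    -- the short of `Q` exists and is unique
    (∃! T : E →L[ℝ] B, IsShort J Q (infoSpan φ) T) ∧
    ∀ T : E →L[ℝ] B, IsShort J Q (infoSpan φ) T →
      -- the Gaussian cylinder measure with covariance `T` exists and is unique,
      -- and with `P_{QΦ}` it forms a saddle point, approximated through Gaussian measures
      (∃! ν : CylinderMeasure B, ν.IsGaussianWith J T) ∧
      (∀ ν : CylinderMeasure B, ν.IsGaussianWith J T →
        IsCylinderSaddle J φ (gambletProjection Q φ) ν ∧
        ∃ μ : ℕ → ProbabilityMeasure B,
          (∀ n, IsGaussian (μ n : Measure B) ∧ ∫ x, x ∂(μ n : Measure B) = 0) ∧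
          IsSaddleApproximation J φ (gambletProjection Q φ) ν μ) ∧
      -- in finite dimensions the Gaussian measure is genuine and the saddle point is exact
      (FiniteDimensional ℝ B →
        (∃! μ : ProbabilityMeasure B, IsCenteredGaussian (μ : Measure B) (covForm J T)) ∧
        ∀ μ : ProbabilityMeasure B, IsCenteredGaussian (μ : Measure B) (covForm J T) →
          IsEpsSaddle J φ 0 (gambletProjection Q φ) μ) := by
  have : SecondCountableTopology B := UniformSpace.secondCountable_of_separable B
  have hS := isShort_starProjection_comp hQ (rfl : _ = gambletSpan (Q : E →L[ℝ] B) φ)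
  refine ⟨⟨_, hS, fun T hT => hT.unique hS⟩, fun T hT => ?_⟩
  -- By uniqueness only the explicit short has to be treated.
  obtain rfl := hT.unique hS
  set K := (gambletSpan (Q : E →L[ℝ] B) φ)ᗮ
  have hK : K ≠ ⊥ := orthogonal_gambletSpan_ne_bot _ φ hdim
  have hcov : ∀ f g, covForm J (K.starProjection ∘L (Q : E →L[ℝ] B)) f g =
      f (K.starProjection ((InnerProductSpace.toDual ℝ B).symm g)) := fun f g => by
    rw [covForm, ← apply_symm_eq_toDual_symm hQ]
    rfl
  have happrox : ∀ ν : CylinderMeasure B,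
      ν.IsGaussianWith J (K.starProjection ∘L (Q : E →L[ℝ] B)) →
      ∃ μ : ℕ → ProbabilityMeasure B,
        (∀ n, IsGaussian (μ n : Measure B) ∧ ∫ x, x ∂(μ n : Measure B) = 0) ∧
        IsSaddleApproximation J φ (gambletProjection (Q : E →L[ℝ] B) φ) ν μ := by
    intro ν hν
    obtain ⟨U, hfin, hbot, hUK, hlim⟩ := exists_finiteDimensional_tendsto_starProjection K hK
    refine ⟨fun n => ⟨gaussianOn (U n), inferInstance⟩, fun n => ⟨isGaussian_gaussianOn (U n),
      (isCenteredGaussian_gaussianOn (U n)).integral_id_eq_zero⟩, ⟨fun F => ?_, fun n _ =>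
      (isEpsSaddle_zero_gaussianOn hQ (hbot n) (hUK n)).mono (by simp)⟩⟩
    have := F.finite_rank
    refine tendsto_of_isCenteredGaussian
      (fun n => (isCenteredGaussian_gaussianOn (U n)).map F.toMap.rangeRestrict) (hν F)
      fun f => ?_
    rw [hcov]
    exact ((f ∘L F.toMap.rangeRestrict).continuous.tendsto _).comp (hlim _)
  refine ⟨?_, fun ν hν => ⟨?_, happrox ν hν⟩, fun hB => ?_⟩
  · obtain ⟨ν, hν⟩ := CylinderMeasure.exists_isGaussianWith (J := J)
      (S := K.starProjection ∘L (Q : E →L[ℝ] B)) fun F => by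
        have := F.finite_rank
        obtain ⟨μ, hμ⟩ := exists_isCenteredGaussian_image K F.toMap.rangeRestrict
        exact ⟨μ, hμ.congr fun f g => by rw [hcov]; rfl⟩
    exact ⟨ν, hν, fun ν' hν' => hν'.unique hν⟩
  · obtain ⟨μ, -, hμ⟩ := happrox ν hν
    exact ⟨μ, hμ⟩
  · have hγ : IsCenteredGaussian (gaussianOn K)
        (covForm J (K.starProjection ∘L (Q : E →L[ℝ] B))) :=
      (isCenteredGaussian_gaussianOn K).congr fun f g => (hcov f g).symm
    have huniq : ∀ μ : ProbabilityMeasure B, IsCenteredGaussian (μ : Measure B)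
        (covForm J (K.starProjection ∘L (Q : E →L[ℝ] B))) →
        μ = ⟨gaussianOn K, inferInstance⟩ := fun μ hμ => Subtype.ext (hμ.ext hγ)
    refine ⟨⟨⟨gaussianOn K, inferInstance⟩, hγ, huniq⟩, fun μ hμ => ?_⟩
    rw [huniq μ hμ]
    exact isEpsSaddle_zero_gaussianOn hQ hK le_rfl
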